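/- Let $f:\mathbb{R}^n\to\mathbb{R}^n$ and $g:\mathbb{R}^n\to\mathbb{R}^{n\times m}$, and consider the control-affine system $$x_{k+1}=f(x_k)+g(x_k)u_k+w_k,\qquad k=0,1,2,\dots,$$ with state $x_k\in\mathbb{R}^n$ and control $u_k\in\mathbb{R}^m$, where $w_0,w_1,\dots$ are independent random vectors with common law $\mathcal{N}(0,\Sigma_w)$ for some (unknown) $\Sigma_w\succeq 0$. A state $x_k$ is called safe if $H_kx_k\le h_k$ componentwise, where $H_k$ is a given real matrix with $n$ columns and $h_k$ a given real vector; $H_k$ and $h_k$ may be random. Let $\delta>0$, let $t>n+1$ be an integer, put $\widehat{\Sigma}_w=\frac1t\sum_{k=0}^{t-1}w_kw_k^\top$, let $\bar u_t$ be a (possibly random) nominal control, and let $\mathbf{d}:\mathbb{R}^m\times\mathbb{R}^m\to\mathbb{R}$ be a function, such as a distance. Consider the robust program $$\min_{u\in\mathbb{R}^m}\ \mathbf{d}(u,\bar u_t)\quad\text{s.t.}\quad H_{t+1}\bigl(f(x_t)+g(x_t)u+w\bigr)\le h_{t+1}\ \ \text{for all } w\in\mathbb{R}^n \text{ with } w^\top\widehat{\Sigma}_w^{-1}w\le\frac{tn}{(t-n-1)\delta},$$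 where, if $\widehat{\Sigma}_w$ is singular, the constraint is imposed for all $w\in\mathbb{R}^n$ (if $\Sigma_w$ is positive definite, this happens with probability zero). The program is called feasible if some $u$ satisfies its constraint. Suppose that, almost surely, $u_t$ is a minimizer of this program whenever the program is feasible. Then: 1. the probability that the program is feasible and $x_{t+1}$ is not safe is at most $\delta$; 2. in particular, if the program is feasible almost surely, then $\mathbb{P}\{H_{t+1}x_{t+1}\le h_{t+1}\}\ge 1-\delta$. -/

import Mathlib

open MeasureTheory ProbabilityTheory Matrix

/-- The empirical covariance `(1/t) ∑_{k<t} w_k w_kᵀ` of a zero-mean sequence of vectors. -/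
noncomputable def empCov {n : ℕ} (t : ℕ) (w : ℕ → Fin n → ℝ) : Matrix (Fin n) (Fin n) ℝ :=
  (t : ℝ)⁻¹ • ∑ k ∈ Finset.range t, vecMulVec (w k) (w k)

/-- The uncertainty set `{w | wᵀ S⁻¹ w ≤ t n / ((t - n - 1) δ)}`, an ellipsoid for positive
definite `S`. For a singular `S` the matrix `S⁻¹` is `0` in Mathlib and the set is everything. -/
def uncertaintySet {n : ℕ} (t : ℕ) (δ : ℝ) (S : Matrix (Fin n) (Fin n) ℝ) : Set (Fin n → ℝ) :=
  {w | w ⬝ᵥ (S⁻¹ *ᵥ w) ≤ ((t : ℝ) * n) / (((t : ℝ) - n - 1) * δ)}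

/-- The controls `u` with `H (F + G u + w) ≤ h` (componentwise) for all `w` in the uncertainty
set; here `F` and `G` are the drift and the input matrix at the current state. -/
def robustFeasibleSet {n m p : ℕ} (t : ℕ) (δ : ℝ) (S : Matrix (Fin n) (Fin n) ℝ)
    (F : Fin n → ℝ) (G : Matrix (Fin n) (Fin m) ℝ)
    (H : Matrix (Fin p) (Fin n) ℝ) (h : Fin p → ℝ) : Set (Fin m → ℝ) :=
  {u | ∀ w ∈ uncertaintySet t δ S, H *ᵥ (F + G *ᵥ u + w) ≤ h}

/-- `u` minimizes the function `cost` over the set `U`. -/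
def IsArgmin {m : ℕ} (cost : (Fin m → ℝ) → ℝ) (U : Set (Fin m → ℝ)) (u : Fin m → ℝ) : Prop :=
  u ∈ U ∧ ∀ v ∈ U, cost u ≤ cost v

section GaussianNegativeMoment

open Real Set Filter Topology

lemma integral_exp_neg_mul_sq_gaussianReal {s : ℝ} (hs : 0 ≤ s) :
    ∫ x, exp (-s * x ^ 2) ∂gaussianReal 0 1 = (1 + 2 * s) ^ (-(1 / 2) : ℝ) := by
  rw [integral_gaussianReal_eq_integral_smul one_ne_zero]
  have h : ∀ x : ℝ, gaussianPDFReal 0 1 x • exp (-s * x ^ 2)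
      = (√(2 * π))⁻¹ * exp (-(s + 1 / 2) * x ^ 2) := by
    intro x
    simp only [gaussianPDFReal, NNReal.coe_one, mul_one, sub_zero, smul_eq_mul]
    rw [mul_assoc, ← exp_add]
    congr 2
    ring
  simp_rw [h]
  rw [integral_const_mul, integral_gaussian, ← sqrt_inv, ← sqrt_mul (by positivity),
    rpow_neg (by positivity), ← sqrt_eq_rpow, ← sqrt_inv]
  congr 1
  have := pi_pos
  field_simp
  ring

variable {E : Type*} [NormedAddCommGroup E] [InnerProductSpace ℝ E] [FiniteDimensional ℝ E]
  [MeasurableSpace E] [BorelSpace E]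

lemma integral_exp_neg_mul_norm_sq_stdGaussian {s : ℝ} (hs : 0 ≤ s) :
    ∫ x, exp (-s * ‖x‖ ^ 2) ∂stdGaussian E
      = (1 + 2 * s) ^ (-(Module.finrank ℝ E / 2) : ℝ) := by
  rw [stdGaussian, integral_map (Measurable.aemeasurable (by fun_prop))
    (by fun_prop)]
  have h : ∀ x : Fin (Module.finrank ℝ E) → ℝ,
      exp (-s * ‖∑ i, x i • stdOrthonormalBasis ℝ E i‖ ^ 2) = ∏ i, exp (-s * x i ^ 2) := by
    intro x
    rw [← exp_sum, ← Finset.mul_sum, ← real_inner_self_eq_norm_sq,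
      (stdOrthonormalBasis ℝ E).orthonormal.inner_sum]
    simp [sq]
  simp_rw [h]
  rw [integral_fintype_prod_eq_pow (fun x : ℝ => exp (-s * x ^ 2)),
    integral_exp_neg_mul_sq_gaussianReal hs, ← rpow_natCast, ← rpow_mul (by positivity)]
  congr 1
  simp
  ring

lemma lintegral_exp_neg_mul_norm_sq_stdGaussian {s : ℝ} (hs : 0 ≤ s) :
    ∫⁻ x, ENNReal.ofReal (exp (-s * ‖x‖ ^ 2)) ∂stdGaussian E
      = ENNReal.ofReal ((1 + 2 * s) ^ (-(Module.finrank ℝ E / 2) : ℝ)) := by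
  rw [← integral_exp_neg_mul_norm_sq_stdGaussian hs, ofReal_integral_eq_lintegral_ofReal]
  · refine Integrable.of_bound (C := 1) (by fun_prop) (ae_of_all _ fun x => ?_)
    rw [norm_of_nonneg (exp_nonneg _), exp_le_one_iff]
    nlinarith [sq_nonneg ‖x‖, mul_nonneg hs (sq_nonneg ‖x‖)]
  · exact ae_of_all _ fun x => exp_nonneg _

lemma lintegral_Ioi_one_add_two_mul_rpow {d : ℝ} (hd : 2 < d) :
    ∫⁻ s in Ioi (0 : ℝ), ENNReal.ofReal ((1 + 2 * s) ^ (-(d / 2)))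
      = ENNReal.ofReal (1 / (d - 2)) := by
  have hderiv : ∀ s ∈ Ici (0 : ℝ),
      HasDerivAt (fun s : ℝ => -(1 + 2 * s) ^ (1 - d / 2) / (d - 2)) ((1 + 2 * s) ^ (-(d / 2))) s := by
    intro s hs
    have hs' : (0 : ℝ) ≤ s := hs
    have h1 : HasDerivAt (fun s : ℝ => 1 + 2 * s) 2 s := by
      simpa using ((hasDerivAt_id s).const_mul 2).const_add 1
    have h2 := ((h1.rpow_const (p := 1 - d / 2) (Or.inl (by positivity))).neg).div_const (d - 2)
    convert! h2 using 1
    rw [show 1 - d / 2 - 1 = -(d / 2) by ring]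
    have : d - 2 ≠ 0 := by linarith
    field_simp
    ring
  have hnonneg : ∀ s ∈ Ioi (0 : ℝ), 0 ≤ (1 + 2 * s) ^ (-(d / 2)) := by
    intro s hs
    have hs' : (0 : ℝ) < s := hs
    positivity
  have htend : Tendsto (fun s : ℝ => -(1 + 2 * s) ^ (1 - d / 2) / (d - 2)) atTop (𝓝 0) := by
    have h1 : Tendsto (fun s : ℝ => 1 + 2 * s) atTop atTop :=
      tendsto_atTop_add_const_left _ _ (tendsto_id.const_mul_atTop (by norm_num))
    have h2 := ((tendsto_rpow_neg_atTop (show 0 < d / 2 - 1 by linarith)).comp h1).neg.div_const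
      (d - 2)
    simpa [Function.comp_def] using h2
  rw [← ofReal_integral_eq_lintegral_ofReal
    (integrableOn_Ioi_deriv_of_nonneg' hderiv hnonneg htend)
    ((ae_restrict_iff' measurableSet_Ioi).2 (ae_of_all _ hnonneg)),
    integral_Ioi_of_hasDerivAt_of_nonneg' hderiv hnonneg htend]
  congr 1
  simp [neg_div]

lemma ofReal_inv_le_lintegral_exp {a : ℝ} (ha : 0 ≤ a) :
    ENNReal.ofReal a⁻¹ ≤ ∫⁻ s in Ioi (0 : ℝ), ENNReal.ofReal (exp (-s * a)) := by
  rcases ha.eq_or_lt with rfl | ha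
  · simp
  have h : ∀ s : ℝ, exp (-s * a) = exp (-a * s) := fun s => by ring_nf
  simp_rw [h]
  rw [← ofReal_integral_eq_lintegral_ofReal (integrableOn_exp_mul_Ioi (by linarith) 0)
    (ae_of_all _ fun x => exp_nonneg _), integral_exp_mul_Ioi (by linarith)]
  simp

/-- The inverse second moment of the norm of a standard Gaussian vector in dimension `d ≥ 3` is
at most `1 / (d - 2)`. -/
lemma lintegral_inv_norm_sq_stdGaussian_le (hd : 2 < Module.finrank ℝ E) :
    ∫⁻ x, ENNReal.ofReal (‖x‖ ^ 2)⁻¹ ∂stdGaussian E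
      ≤ ENNReal.ofReal (1 / ((Module.finrank ℝ E : ℝ) - 2)) := by
  calc ∫⁻ x, ENNReal.ofReal (‖x‖ ^ 2)⁻¹ ∂stdGaussian E
      ≤ ∫⁻ x, (∫⁻ s in Ioi (0 : ℝ), ENNReal.ofReal (exp (-s * ‖x‖ ^ 2))) ∂stdGaussian E :=
        lintegral_mono fun x => ofReal_inv_le_lintegral_exp (sq_nonneg _)
    _ = ∫⁻ s in Ioi (0 : ℝ), ∫⁻ x, ENNReal.ofReal (exp (-s * ‖x‖ ^ 2)) ∂stdGaussian E :=
        lintegral_lintegral_swap (by fun_prop)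
    _ = ∫⁻ s in Ioi (0 : ℝ), ENNReal.ofReal ((1 + 2 * s) ^ (-(Module.finrank ℝ E / 2) : ℝ)) :=
        setLIntegral_congr_fun measurableSet_Ioi fun s hs =>
          lintegral_exp_neg_mul_norm_sq_stdGaussian (le_of_lt hs)
    _ = _ := lintegral_Ioi_one_add_two_mul_rpow (by exact_mod_cast hd)

lemma map_orthogonalProjection_stdGaussian (K : Submodule ℝ E) :
    (stdGaussian E).map K.orthogonalProjectionOnto = stdGaussian K := by
  apply Measure.ext_of_charFun
  ext y
  rw [charFun_stdGaussian, charFun_apply, integral_map (by fun_prop) (by fun_prop)]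
  have h : ∀ x : E, inner ℝ (K.orthogonalProjectionOnto x) y = inner ℝ x (y : E) := fun x => by
    rw [← Submodule.inner_orthogonalProjectionOnto_eq_of_mem_right]
  simp_rw [h]
  rw [← charFun_apply, charFun_stdGaussian]
  simp

/-- The inverse squared norm of the projection of a standard Gaussian vector onto a subspace of
dimension at least `k ≥ 3` has expectation at most `1 / (k - 2)`. -/
lemma lintegral_inv_norm_sq_orthogonalProjection_le (K : Submodule ℝ E) {k : ℕ} (hk : 2 < k)
    (hK : k ≤ Module.finrank ℝ K) :
    ∫⁻ x, ENNReal.ofReal (‖K.orthogonalProjectionOnto x‖ ^ 2)⁻¹ ∂stdGaussian E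
      ≤ ENNReal.ofReal (1 / ((k : ℝ) - 2)) := by
  have h := lintegral_inv_norm_sq_stdGaussian_le (E := K) (hk.trans_le hK)
  rw [← map_orthogonalProjection_stdGaussian K,
    lintegral_map (by fun_prop) (by fun_prop)] at h
  refine h.trans (ENNReal.ofReal_le_ofReal ?_)
  have h1 : (2 : ℝ) < k := by exact_mod_cast hk
  have h2 : (k : ℝ) ≤ Module.finrank ℝ K := by exact_mod_cast hK
  gcongr

end GaussianNegativeMoment

section InverseGram

/-- A diagonal entry of the inverse of a Gram matrix is bounded by the inverse squared distance of
the corresponding vector to the span of the others. -/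
lemma inv_gram_diag_le {E : Type*} [NormedAddCommGroup E] [InnerProductSpace ℝ E]
    [FiniteDimensional ℝ E] {ι : Type*} [Fintype ι] [DecidableEq ι] (r : ι → E) (i : ι)
    (K : Submodule ℝ E) (hK : K = Submodule.span ℝ (r '' {i}ᶜ)) :
    (Matrix.gram ℝ r)⁻¹ i i ≤ (‖Kᗮ.orthogonalProjectionOnto (r i)‖ ^ 2)⁻¹ := by
  set A := Matrix.gram ℝ r with hA
  by_cases hdet : IsUnit A.det
  swap
  · rw [nonsing_inv_apply_not_isUnit _ hdet]
    simp
  set v : E := ∑ j, A⁻¹ j i • r j with hv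
  have hinner : ∀ k, inner ℝ (r k) v = (1 : Matrix ι ι ℝ) k i := by
    intro k
    rw [← mul_nonsing_inv A hdet, Matrix.mul_apply, hv, inner_sum]
    refine Finset.sum_congr rfl fun j _ => ?_
    rw [inner_smul_right, mul_comm, hA, gram_apply]
  have hproj : ∀ j, j ≠ i → Kᗮ.orthogonalProjectionOnto (r j) = 0 := by
    intro j hj
    refine Submodule.orthogonalProjectionOnto_orthogonal_apply_eq_zero ?_
    rw [hK]
    exact Submodule.subset_span ⟨j, hj, rfl⟩
  have hvK : v ∈ Kᗮ := by
    rw [Submodule.mem_orthogonal, hK]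
    intro y hy
    induction hy using Submodule.span_induction with
    | mem y hy =>
      obtain ⟨j, hj, rfl⟩ := hy
      rw [hinner, one_apply_ne hj]
    | zero => simp
    | add y z _ _ h1 h2 => rw [inner_add_left, h1, h2, add_zero]
    | smul c y _ h1 => rw [inner_smul_left, h1, mul_zero]
  have hv1 : ‖v‖ ^ 2 = A⁻¹ i i := by
    rw [← real_inner_self_eq_norm_sq]
    nth_rewrite 1 [hv]
    rw [sum_inner, Finset.sum_eq_single i]
    · simp [inner_smul_left, hinner]
    · intro j _ hj
      rw [inner_smul_left, hinner, one_apply_ne hj, mul_zero]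
    · simp
  have hv2 : Kᗮ.orthogonalProjectionOnto v = A⁻¹ i i • Kᗮ.orthogonalProjectionOnto (r i) := by
    rw [hv, map_sum, Finset.sum_eq_single i]
    · rw [map_smul]
    · intro j _ hj
      rw [map_smul, hproj j hj, smul_zero]
    · simp
  have hv3 : ‖Kᗮ.orthogonalProjectionOnto v‖ = ‖v‖ := by
    rw [Submodule.coe_norm, Submodule.coe_orthogonalProjectionOnto_apply,
      Submodule.starProjection_eq_self_iff.2 hvK]
  have key : A⁻¹ i i = (A⁻¹ i i) ^ 2 * ‖Kᗮ.orthogonalProjectionOnto (r i)‖ ^ 2 := by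
    rw [← mul_pow]
    conv_lhs => rw [← hv1, ← hv3, hv2, norm_smul, mul_pow, Real.norm_eq_abs, sq_abs, ← mul_pow]
  rcases eq_or_ne (A⁻¹ i i) 0 with h0 | h0
  · rw [h0]
    positivity
  · refine (eq_inv_of_mul_eq_one_left ?_).le
    have : A⁻¹ i i * (A⁻¹ i i * ‖Kᗮ.orthogonalProjectionOnto (r i)‖ ^ 2) = A⁻¹ i i * 1 := by
      rw [mul_one]; conv_rhs => rw [key]
      ring
    exact mul_left_cancel₀ h0 this

lemma measurable_matrix_inv_apply {α ι : Type*} [MeasurableSpace α] [Fintype ι] [DecidableEq ι]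
    {A : α → Matrix ι ι ℝ} (hA : ∀ i j, Measurable fun a => A a i j) (i j : ι) :
    Measurable fun a => (A a)⁻¹ i j := by
  have hA' : Measurable (β := ι → ι → ℝ) A :=
    measurable_pi_lambda _ fun i => measurable_pi_lambda _ fun j => hA i j
  have hdet : Measurable fun a => (A a).det :=
    (show Continuous fun B : ι → ι → ℝ => Matrix.det (Matrix.of B) by
      exact Continuous.matrix_det continuous_id).measurable.comp hA'
  have hadj : Measurable fun a => (A a).adjugate i j :=
    (show Continuous fun B : ι → ι → ℝ => (Matrix.of B).adjugate i j by
      exact (Continuous.matrix_adjugate continuous_id).matrix_elem i j).measurable.comp hA'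
  simp only [inv_def, Ring.inverse_eq_inv', Matrix.smul_apply, smul_eq_mul]
  exact hdet.inv.mul hadj

/-- The diagonal entries of the inverse of a standard Wishart matrix with `t` degrees of freedom
have expectation at most `1 / (t - n - 1)`. -/
lemma lintegral_inv_gram_diag_le {n t : ℕ} (ht : n + 1 < t) (i : Fin n) :
    ∫⁻ r, ENNReal.ofReal ((Matrix.gram ℝ r)⁻¹ i i)
      ∂Measure.pi (fun _ : Fin n => stdGaussian (EuclideanSpace ℝ (Fin t)))
      ≤ ENNReal.ofReal (1 / ((t : ℝ) - n - 1)) := by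
  obtain _ | n := n
  · exact i.elim0
  set γ := stdGaussian (EuclideanSpace ℝ (Fin t))
  set e := MeasurableEquiv.piFinSuccAbove (fun _ : Fin (n + 1) => EuclideanSpace ℝ (Fin t)) i
  have he := (measurePreserving_piFinSuccAbove (fun _ : Fin (n + 1) => γ) i).symm
  set F : (Fin (n + 1) → EuclideanSpace ℝ (Fin t)) → ENNReal :=
    fun r => ENNReal.ofReal ((Matrix.gram ℝ r)⁻¹ i i) with hF
  have hmeas : Measurable F := by
    refine (measurable_matrix_inv_apply (fun i j => ?_) i i).ennreal_ofReal
    simp only [gram_apply]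
    fun_prop
  calc ∫⁻ r, F r ∂Measure.pi (fun _ : Fin (n + 1) => γ)
      = ∫⁻ a, F (e.symm a) ∂γ.prod (Measure.pi fun _ : Fin n => γ) :=
        (he.lintegral_comp hmeas).symm
    _ = ∫⁻ y, ∫⁻ x, F (e.symm (x, y)) ∂γ ∂Measure.pi (fun _ : Fin n => γ) :=
        lintegral_prod_symm _ (hmeas.comp e.symm.measurable).aemeasurable
    _ ≤ ∫⁻ _, ENNReal.ofReal (1 / ((t : ℝ) - (n + 1 : ℕ) - 1)) ∂Measure.pi (fun _ : Fin n => γ) := by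
        refine lintegral_mono fun y => ?_
        set K : Submodule ℝ (EuclideanSpace ℝ (Fin t)) := Submodule.span ℝ (Set.range y) with hKdef
        have hK : ∀ x, K = Submodule.span ℝ ((e.symm (x, y)) '' {i}ᶜ) := by
          intro x
          rw [hKdef, ← Fin.range_succAbove, ← Set.range_comp]
          congr 2
          ext1 j
          simp [e]
        have hrank : t - n ≤ Module.finrank ℝ Kᗮ := by
          have h1 : Module.finrank ℝ K ≤ n := by
            simpa [Set.finrank] using finrank_range_le_card (R := ℝ) y
          have h2 := K.finrank_add_finrank_orthogonal
          rw [finrank_euclideanSpace_fin] at h2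
          have h3 : ∀ a b : ℕ, a ≤ n → a + b = t → t - n ≤ b := by lia
          exact h3 _ _ h1 h2
        have h := lintegral_inv_norm_sq_orthogonalProjection_le Kᗮ (k := t - n) (by lia) hrank
        have hcast : ((t - n : ℕ) : ℝ) - 2 = (t : ℝ) - (n + 1 : ℕ) - 1 := by
          rw [Nat.cast_sub (by lia)]
          push_cast
          ring
        rw [hcast] at h
        refine le_trans (lintegral_mono fun x => ENNReal.ofReal_le_ofReal ?_) h
        have := inv_gram_diag_le (e.symm (x, y)) i K (hK x)
        simpa [e] using this
    _ = _ := by simp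

end InverseGram

section Product

/-- Transposing a matrix with i.i.d. entries preserves its law. -/
lemma measurePreserving_pi_swap {ι κ α : Type*} [Fintype ι] [Fintype κ] [MeasurableSpace α]
    (μ : Measure α) [IsProbabilityMeasure μ] :
    MeasurePreserving (fun (z : κ → ι → α) i k => z k i)
      (Measure.pi fun _ : κ => Measure.pi fun _ : ι => μ)
      (Measure.pi fun _ : ι => Measure.pi fun _ : κ => μ) := by
  refine ⟨by fun_prop, ?_⟩
  symm
  refine Measure.pi_eq_generateFrom
    (C := fun _ => Set.pi Set.univ '' Set.pi Set.univ fun _ : κ => {s : Set α | MeasurableSet s})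
    (fun _ => generateFrom_pi) (fun _ => isPiSystem_pi)
    (fun _ => Measure.FiniteSpanningSetsIn.pi fun _ => μ.toFiniteSpanningSetsIn) ?_
  intro s hs
  choose b hb hbs using hs
  obtain rfl : (fun i => Set.pi Set.univ (b i)) = s := funext hbs
  have hb' : ∀ i k, MeasurableSet (b i k) := fun i k => hb i k (Set.mem_univ k)
  rw [Measure.map_apply (by fun_prop)
    (MeasurableSet.univ_pi fun i => MeasurableSet.univ_pi fun k => hb' i k)]
  have : (fun (z : κ → ι → α) i k => z k i) ⁻¹'
      (Set.pi Set.univ fun i => Set.pi Set.univ (b i))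
      = Set.pi Set.univ fun k => Set.pi Set.univ fun i => b i k := by
    ext z
    simp only [Set.mem_preimage, Set.mem_univ_pi]
    exact forall_comm
  rw [this, Measure.pi_pi]
  simp_rw [Measure.pi_pi]
  exact Finset.prod_comm

lemma integral_eval_mul_eval_pi_gaussianReal {ι : Type*} [Fintype ι] [DecidableEq ι] (i j : ι) :
    ∫ x, x i * x j ∂Measure.pi (fun _ : ι => gaussianReal 0 1) = (1 : Matrix ι ι ℝ) i j := by
  have hmean : ∀ i, ∫ x, x i ∂Measure.pi (fun _ : ι => gaussianReal 0 1) = 0 := fun i => by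
    rw [integral_comp_eval (μ := fun _ : ι => gaussianReal 0 1) (i := i) (f := fun y : ℝ => y)
      (by fun_prop)]
    exact integral_id_gaussianReal
  rcases eq_or_ne i j with rfl | hij
  · rw [one_apply_eq, integral_comp_eval (μ := fun _ : ι => gaussianReal 0 1) (i := i)
      (f := fun y : ℝ => y * y) (by fun_prop)]
    have h := variance_eq_sub (memLp_id_gaussianReal (μ := 0) (v := 1) 2)
    rw [variance_id_gaussianReal] at h
    simp only [id_eq, integral_id_gaussianReal, Pi.pow_apply] at h
    simp_rw [← sq]
    simpa using h.symm
  · rw [one_apply_ne hij]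
    have hind : IndepFun (fun x : ι → ℝ => x i) (fun x => x j)
        (Measure.pi fun _ : ι => gaussianReal 0 1) :=
      (iIndepFun_pi (X := fun _ : ι => id) (fun _ => aemeasurable_id)).indepFun hij
    rw [hind.integral_fun_mul_eq_mul_integral (measurable_pi_apply i).aestronglyMeasurable
      (measurable_pi_apply j).aestronglyMeasurable, hmean, zero_mul]

lemma integrable_eval_mul_eval_pi_gaussianReal {ι : Type*} [Fintype ι] (i j : ι) :
    Integrable (fun x : ι → ℝ => x i * x j) (Measure.pi fun _ : ι => gaussianReal 0 1) := by
  have h : ∀ i, MemLp (fun x : ι → ℝ => x i) 2 (Measure.pi fun _ : ι => gaussianReal 0 1) :=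
    fun i => (memLp_id_gaussianReal (μ := 0) (v := 1) 2).comp_measurePreserving
      (measurePreserving_eval _ i)
  exact (h i).integrable_mul (h j)

lemma lintegral_quadratic_form_pi_gaussianReal {ι : Type*} [Fintype ι] [DecidableEq ι]
    {M : Matrix ι ι ℝ} (hM : M.PosSemidef) :
    ∫⁻ x, ENNReal.ofReal (x ⬝ᵥ (M *ᵥ x)) ∂Measure.pi (fun _ : ι => gaussianReal 0 1)
      = ENNReal.ofReal M.trace := by
  have hsum : ∀ x : ι → ℝ, x ⬝ᵥ (M *ᵥ x) = ∑ i, ∑ j, M i j * (x i * x j) := by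
    intro x
    simp only [dotProduct, mulVec, Finset.mul_sum]
    exact Finset.sum_congr rfl fun i _ => Finset.sum_congr rfl fun j _ => by ring
  have hint : ∀ i j, Integrable (fun x : ι → ℝ => M i j * (x i * x j))
      (Measure.pi fun _ : ι => gaussianReal 0 1) := fun i j =>
    (integrable_eval_mul_eval_pi_gaussianReal i j).const_mul _
  rw [← ofReal_integral_eq_lintegral_ofReal]
  · simp_rw [hsum]
    rw [integral_finsetSum _ fun i _ => integrable_finsetSum _ fun j _ => hint i j]
    simp_rw [integral_finsetSum _ fun j _ => hint _ j, integral_const_mul,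
      integral_eval_mul_eval_pi_gaussianReal, one_apply]
    simp [Matrix.trace]
  · simp_rw [hsum]
    exact integrable_finsetSum _ fun i _ => integrable_finsetSum _ fun j _ => hint i j
  · exact ae_of_all _ fun x => by simpa using hM.dotProduct_mulVec_nonneg x

end Product

section Wishart

variable {n t : ℕ}

/-- The scatter matrix `∑ k, z_k z_kᵀ` of a finite family of vectors. -/
def scatter (z : Fin t → Fin n → ℝ) : Matrix (Fin n) (Fin n) ℝ := ∑ k, vecMulVec (z k) (z k)

lemma scatter_eq_gram (z : Fin t → Fin n → ℝ) :
    scatter z = Matrix.gram ℝ fun i => WithLp.toLp 2 fun k => z k i := by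
  ext i j
  simp [scatter, Matrix.sum_apply, vecMulVec_apply, gram_apply, PiLp.inner_apply, mul_comm]

lemma posSemidef_scatter (z : Fin t → Fin n → ℝ) : (scatter z).PosSemidef := by
  rw [scatter_eq_gram]
  exact posSemidef_gram ℝ _

lemma measurable_scatter_inv_apply (i j : Fin n) :
    Measurable fun z : Fin t → Fin n → ℝ => (scatter z)⁻¹ i j := by
  refine measurable_matrix_inv_apply (fun i j => ?_) i j
  simp only [scatter, Matrix.sum_apply, vecMulVec_apply]
  fun_prop

/-- The law of a standard Gaussian vector in `ℝⁿ`. -/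
noncomputable abbrev piGaussian (n : ℕ) : Measure (Fin n → ℝ) :=
  Measure.pi fun _ => gaussianReal 0 1

lemma lintegral_scatter_inv_diag_le (ht : n + 1 < t) (i : Fin n) :
    ∫⁻ z, ENNReal.ofReal ((scatter z)⁻¹ i i) ∂Measure.pi (fun _ : Fin t => piGaussian n)
      ≤ ENNReal.ofReal (1 / ((t : ℝ) - n - 1)) := by
  have hmeas : Measurable fun r : Fin n → EuclideanSpace ℝ (Fin t) =>
      ENNReal.ofReal ((Matrix.gram ℝ r)⁻¹ i i) := by
    refine (measurable_matrix_inv_apply (fun i j => ?_) i i).ennreal_ofReal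
    simp only [gram_apply]
    fun_prop
  have h1 : MeasurePreserving (WithLp.toLp 2) (piGaussian t)
      (stdGaussian (EuclideanSpace ℝ (Fin t))) := ⟨by fun_prop, map_pi_eq_stdGaussian⟩
  have h2 := (measurePreserving_pi (fun _ : Fin n => piGaussian t) _ fun _ => h1).comp
    (measurePreserving_pi_swap (ι := Fin n) (κ := Fin t) (gaussianReal 0 1))
  have h3 := h2.lintegral_comp hmeas
  refine le_trans (le_of_eq ?_) (h3.le.trans (lintegral_inv_gram_diag_le ht i))
  refine lintegral_congr fun z => ?_
  rw [scatter_eq_gram]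
  rfl

lemma measurable_mahalanobis :
    Measurable fun a : (Fin n → ℝ) × (Fin t → Fin n → ℝ) =>
      a.1 ⬝ᵥ ((scatter a.2)⁻¹ *ᵥ a.1) := by
  simp only [dotProduct, mulVec]
  refine Finset.measurable_fun_sum _ fun i _ => Measurable.mul (by fun_prop) ?_
  refine Finset.measurable_fun_sum _ fun j _ => Measurable.mul ?_ (by fun_prop)
  exact (measurable_scatter_inv_apply i j).comp measurable_snd

/-- The expected squared Mahalanobis norm of a standard Gaussian vector with respect to the scatter
matrix of an independent standard Gaussian sample. -/
lemma lintegral_mahalanobis_le (ht : n + 1 < t) :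
    ∫⁻ a, ENNReal.ofReal (a.1 ⬝ᵥ ((scatter a.2)⁻¹ *ᵥ a.1))
      ∂(piGaussian n).prod (Measure.pi fun _ : Fin t => piGaussian n)
      ≤ ENNReal.ofReal (n / ((t : ℝ) - n - 1)) := by
  rw [lintegral_prod_symm _ measurable_mahalanobis.ennreal_ofReal.aemeasurable]
  calc ∫⁻ z, ∫⁻ x, ENNReal.ofReal (x ⬝ᵥ ((scatter z)⁻¹ *ᵥ x)) ∂piGaussian n
        ∂Measure.pi (fun _ : Fin t => piGaussian n)
      = ∫⁻ z, ∑ i, ENNReal.ofReal ((scatter z)⁻¹ i i)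
          ∂Measure.pi (fun _ : Fin t => piGaussian n) := by
        refine lintegral_congr fun z => ?_
        rw [lintegral_quadratic_form_pi_gaussianReal (posSemidef_scatter z).inv]
        exact ENNReal.ofReal_sum_of_nonneg fun i _ => (posSemidef_scatter z).inv.diag_nonneg
    _ = ∑ i, ∫⁻ z, ENNReal.ofReal ((scatter z)⁻¹ i i)
          ∂Measure.pi (fun _ : Fin t => piGaussian n) :=
        lintegral_finsetSum _ fun i _ => (measurable_scatter_inv_apply i i).ennreal_ofReal
    _ ≤ ∑ _ : Fin n, ENNReal.ofReal (1 / ((t : ℝ) - n - 1)) :=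
        Finset.sum_le_sum fun i _ => lintegral_scatter_inv_diag_le ht i
    _ = ENNReal.ofReal (n / ((t : ℝ) - n - 1)) := by
        rw [Finset.sum_const, Finset.card_univ, Fintype.card_fin, nsmul_eq_mul,
          ← ENNReal.ofReal_natCast, ← ENNReal.ofReal_mul (by positivity)]
        congr 1
        ring

end Wishart

section Whitening

open scoped MatrixOrder

variable {n t : ℕ}

lemma scatter_mulVec (B : Matrix (Fin n) (Fin n) ℝ) (z : Fin t → Fin n → ℝ) :
    scatter (fun k => B *ᵥ z k) = B * scatter z * Bᵀ := by
  simp only [scatter, Finset.mul_sum, Finset.sum_mul]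
  refine Finset.sum_congr rfl fun k _ => ?_
  rw [mul_vecMulVec, vecMulVec_mul, vecMul_transpose]

/-- The Mahalanobis norm with respect to the scatter matrix does not increase under linear maps. It
is invariant under the invertible ones, and the junk value of the inverse makes it vanish for the
others. -/
lemma mahalanobis_mulVec_le (B : Matrix (Fin n) (Fin n) ℝ) (x : Fin n → ℝ)
    (z : Fin t → Fin n → ℝ) :
    (B *ᵥ x) ⬝ᵥ ((scatter fun k => B *ᵥ z k)⁻¹ *ᵥ (B *ᵥ x)) ≤ x ⬝ᵥ ((scatter z)⁻¹ *ᵥ x) := by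
  rw [scatter_mulVec, Matrix.mul_inv_rev, Matrix.mul_inv_rev]
  by_cases hB : IsUnit B.det
  · rw [← transpose_nonsing_inv, ← mulVec_mulVec, ← mulVec_mulVec, mulVec_mulVec x B⁻¹ B,
      nonsing_inv_mul B hB, one_mulVec, dotProduct_mulVec, vecMul_transpose, mulVec_mulVec,
      nonsing_inv_mul B hB, one_mulVec]
  · rw [nonsing_inv_apply_not_isUnit B hB]
    simpa using (posSemidef_scatter z).inv.dotProduct_mulVec_nonneg x

lemma empCov_eq_smul_scatter (w : ℕ → Fin n → ℝ) :
    empCov t w = (t : ℝ)⁻¹ • scatter fun k : Fin t => w k := by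
  rw [empCov, scatter, Finset.sum_range]

lemma inv_empCov (ht : 0 < t) (w : ℕ → Fin n → ℝ) :
    (empCov t w)⁻¹ = (t : ℝ) • (scatter fun k : Fin t => w k)⁻¹ := by
  have ht' : (t : ℝ) ≠ 0 := by positivity
  rw [empCov_eq_smul_scatter]
  by_cases h : IsUnit (scatter fun k : Fin t => w k).det
  · have := inv_smul' (scatter fun k : Fin t => w k) (Units.mk0 ((t : ℝ)⁻¹) (inv_ne_zero ht')) h
    simpa [Units.smul_def] using this
  · rw [nonsing_inv_apply_not_isUnit _ h, smul_zero, nonsing_inv_apply_not_isUnit]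
    rw [det_smul]
    rw [isUnit_iff_ne_zero, not_not] at h ⊢
    rw [h, mul_zero]

lemma map_eq_of_hasLaw_multivariateGaussian {Ω : Type*} [MeasurableSpace Ω] {P : Measure Ω}
    {w : Ω → Fin n → ℝ} {Sigma : Matrix (Fin n) (Fin n) ℝ}
    (hw : HasLaw (fun ω => WithLp.toLp 2 (w ω)) (multivariateGaussian 0 Sigma) P) :
    AEMeasurable w P ∧
      P.map w = (piGaussian n).map fun x => CFC.sqrt Sigma *ᵥ x := by
  have hofLp : Measurable (WithLp.ofLp : EuclideanSpace ℝ (Fin n) → Fin n → ℝ) := by fun_prop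
  refine ⟨hofLp.comp_aemeasurable hw.aemeasurable, ?_⟩
  have h1 : P.map w = (multivariateGaussian 0 Sigma).map WithLp.ofLp := by
    rw [← hw.map_eq, AEMeasurable.map_map_of_aemeasurable hofLp.aemeasurable hw.aemeasurable]
    rfl
  rw [h1, multivariateGaussian, ← map_pi_eq_stdGaussian, Measure.map_map (by fun_prop)
    (by fun_prop), Measure.map_map (by fun_prop) (by fun_prop)]
  congr 1
  ext x i
  simp

/-- With probability at least `1 - δ`, a Gaussian vector lies in the uncertainty set built from
an independent Gaussian sample with the same centred law. -/
lemma measure_notMem_uncertaintySet_le {Ω : Type*} [MeasurableSpace Ω] (P : Measure Ω)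
    [IsProbabilityMeasure P] (w : ℕ → Ω → Fin n → ℝ) (Sigma : Matrix (Fin n) (Fin n) ℝ)
    (hw_indep : iIndepFun w P)
    (hw_law : ∀ k, HasLaw (fun ω => WithLp.toLp 2 (w k ω)) (multivariateGaussian 0 Sigma) P)
    {δ : ℝ} (hδ : 0 < δ) (ht : n + 1 < t) :
    P {ω | w t ω ∉ uncertaintySet t δ (empCov t fun k => w k ω)} ≤ ENNReal.ofReal δ := by
  have ht0 : (0 : ℝ) < t := by
    have : 0 < t := by lia
    exact_mod_cast this
  have hpos : (0 : ℝ) < (t : ℝ) - n - 1 := by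
    have : ((n + 1 : ℕ) : ℝ) < t := by exact_mod_cast ht
    push_cast at this
    linarith
  rcases Nat.eq_zero_or_pos n with rfl | hn
  · have : {ω | w t ω ∉ uncertaintySet t δ (empCov t fun k => w k ω)} = ∅ := by
      ext ω
      simp [uncertaintySet]
    rw [this]
    simp
  set B := CFC.sqrt Sigma
  set c : ℝ := n / (((t : ℝ) - n - 1) * δ) with hc
  have hn' : (0 : ℝ) < n := by exact_mod_cast hn
  have hcpos : 0 < c := by positivity
  set q : (Fin n → ℝ) × (Fin t → Fin n → ℝ) → ℝ := fun a => a.1 ⬝ᵥ ((scatter a.2)⁻¹ *ᵥ a.1)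
    with hq
  set e := MeasurableEquiv.piFinSuccAbove (fun _ : Fin (t + 1) => Fin n → ℝ) (Fin.last t)
  set s : Set (Fin (t + 1) → Fin n → ℝ) := {y | c < q (e y)} with hs
  have hsmeas : MeasurableSet s :=
    measurableSet_lt measurable_const (measurable_mahalanobis.comp e.measurable)
  have hmeas : ∀ k : Fin (t + 1), AEMeasurable (w k) P := fun k =>
    (map_eq_of_hasLaw_multivariateGaussian (hw_law k)).1
  have hindep : iIndepFun (fun k : Fin (t + 1) => w k) P := hw_indep.precomp Fin.val_injective
  have hmap : P.map (fun ω (k : Fin (t + 1)) => w k ω)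
      = (Measure.pi fun _ : Fin (t + 1) => piGaussian n).map fun y k => B *ᵥ y k := by
    rw [hindep.map_fun_eq_pi_map hmeas, Measure.pi_map_pi (by fun_prop)]
    congr 1
    ext1 k
    exact (map_eq_of_hasLaw_multivariateGaussian (hw_law k)).2
  have hsub : {ω | w t ω ∉ uncertaintySet t δ (empCov t fun k => w k ω)}
      ⊆ (fun ω (k : Fin (t + 1)) => w k ω) ⁻¹' s := by
    intro ω hω
    simp only [uncertaintySet, Set.mem_ofPred_eq, not_le,
      inv_empCov (show 0 < t by lia), smul_mulVec, dotProduct_smul, smul_eq_mul] at hω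
    rw [mul_div_assoc] at hω
    have := lt_of_mul_lt_mul_left hω ht0.le
    simpa [hs, hq, e, Fin.init_def, hc] using this
  calc P {ω | w t ω ∉ uncertaintySet t δ (empCov t fun k => w k ω)}
      ≤ P ((fun ω (k : Fin (t + 1)) => w k ω) ⁻¹' s) := measure_mono hsub
    _ = P.map (fun ω (k : Fin (t + 1)) => w k ω) s :=
        (Measure.map_apply_of_aemeasurable (aemeasurable_pi_lambda _ hmeas) hsmeas).symm
    _ = (Measure.pi fun _ : Fin (t + 1) => piGaussian n) ((fun y k => B *ᵥ y k) ⁻¹' s) := by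
        rw [hmap, Measure.map_apply (by fun_prop) hsmeas]
    _ ≤ (Measure.pi fun _ : Fin (t + 1) => piGaussian n) (e ⁻¹' {a | c ≤ q a}) := by
        refine measure_mono fun y hy => ?_
        have hy' : c < q (B *ᵥ (e y).1, fun k => B *ᵥ (e y).2 k) := hy
        exact hy'.le.trans (mahalanobis_mulVec_le B _ _)
    _ = ((piGaussian n).prod (Measure.pi fun _ : Fin t => piGaussian n)) {a | c ≤ q a} :=
        (measurePreserving_piFinSuccAbove (fun _ : Fin (t + 1) => piGaussian n)
          (Fin.last t)).measure_preimage
          (measurableSet_le measurable_const measurable_mahalanobis).nullMeasurableSet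
    _ ≤ ((piGaussian n).prod (Measure.pi fun _ : Fin t => piGaussian n))
          {a | ENNReal.ofReal c ≤ ENNReal.ofReal (q a)} :=
        measure_mono fun a ha => ENNReal.ofReal_le_ofReal ha
    _ ≤ (∫⁻ a, ENNReal.ofReal (q a)
          ∂(piGaussian n).prod (Measure.pi fun _ : Fin t => piGaussian n)) / ENNReal.ofReal c :=
        meas_ge_le_lintegral_div measurable_mahalanobis.ennreal_ofReal.aemeasurable
          (by simpa using hcpos) ENNReal.ofReal_ne_top
    _ ≤ ENNReal.ofReal (n / ((t : ℝ) - n - 1)) / ENNReal.ofReal c := by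
        gcongr
        exact lintegral_mahalanobis_le ht
    _ = ENNReal.ofReal δ := by
        rw [← ENNReal.ofReal_div_of_pos hcpos]
        congr 1
        rw [hc]
        field_simp

end Whitening

theorem theorem1
    {Ω : Type*} [MeasurableSpace Ω] (P : Measure Ω) [IsProbabilityMeasure P]
    {n m : ℕ} (p : ℕ → ℕ)
    -- the process noise: i.i.d. centred Gaussian vectors with covariance `Sigma`
    (w : ℕ → Ω → Fin n → ℝ) (Sigma : Matrix (Fin n) (Fin n) ℝ) (hSigma : Sigma.PosSemidef)
    (hw_indep : iIndepFun w P)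
    (hw_law : ∀ k, HasLaw (fun ω => WithLp.toLp 2 (w k ω)) (multivariateGaussian 0 Sigma) P)
    -- the control-affine system
    (f : (Fin n → ℝ) → Fin n → ℝ) (g : (Fin n → ℝ) → Matrix (Fin n) (Fin m) ℝ)
    (x : ℕ → Ω → Fin n → ℝ) (u : ℕ → Ω → Fin m → ℝ)
    (hx : ∀ k ω, x (k + 1) ω = f (x k ω) + g (x k ω) *ᵥ u k ω + w k ω)
    -- the safety constraints `H_k x_k ≤ h_k`, possibly depending on past data
    (H : (k : ℕ) → Ω → Matrix (Fin (p k)) (Fin n) ℝ) (h : (k : ℕ) → Ω → Fin (p k) → ℝ)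
    -- the nominal control and the function measuring the distance to it
    (ubar : ℕ → Ω → Fin m → ℝ) (dist : (Fin m → ℝ) → (Fin m → ℝ) → ℝ)
    (δ : ℝ) (hδ : 0 < δ) (t : ℕ) (ht : n + 1 < t)
    -- whenever the robust program at time `t` is feasible, `u_t` solves it
    (hu : ∀ᵐ ω ∂P,
      (robustFeasibleSet t δ (empCov t fun k => w k ω) (f (x t ω)) (g (x t ω))
        (H (t + 1) ω) (h (t + 1) ω)).Nonempty →
      IsArgmin (fun v => dist v (ubar t ω))
        (robustFeasibleSet t δ (empCov t fun k => w k ω) (f (x t ω)) (g (x t ω))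
          (H (t + 1) ω) (h (t + 1) ω))
        (u t ω)) :
    -- the program is feasible and the next state is unsafe with probability at most `δ`
    P.real {ω |
        (robustFeasibleSet t δ (empCov t fun k => w k ω) (f (x t ω)) (g (x t ω))
          (H (t + 1) ω) (h (t + 1) ω)).Nonempty ∧
        ¬ H (t + 1) ω *ᵥ x (t + 1) ω ≤ h (t + 1) ω} ≤ δ ∧
    -- if the program is feasible, the next state is safe with probability at least `1 - δ`
    ((∀ᵐ ω ∂P, (robustFeasibleSet t δ (empCov t fun k => w k ω) (f (x t ω)) (g (x t ω))
        (H (t + 1) ω) (h (t + 1) ω)).Nonempty) →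
      1 - δ ≤ P.real {ω | H (t + 1) ω *ᵥ x (t + 1) ω ≤ h (t + 1) ω}) := by
  set R := fun ω => robustFeasibleSet t δ (empCov t fun k => w k ω) (f (x t ω)) (g (x t ω))
    (H (t + 1) ω) (h (t + 1) ω)
  have hbad : P {ω | (R ω).Nonempty ∧ ¬ H (t + 1) ω *ᵥ x (t + 1) ω ≤ h (t + 1) ω}
      ≤ ENNReal.ofReal δ := by
    refine (measure_mono_ae ?_).trans
      (measure_notMem_uncertaintySet_le P w Sigma hw_indep hw_law hδ ht)
    filter_upwards [hu] with ω hω hbad hmem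
    refine hbad.2 ?_
    rw [hx]
    exact (hω hbad.1).1 _ hmem
  have hbad' : P.real {ω | (R ω).Nonempty ∧ ¬ H (t + 1) ω *ᵥ x (t + 1) ω ≤ h (t + 1) ω} ≤ δ :=
    ENNReal.toReal_le_of_le_ofReal hδ.le hbad
  refine ⟨hbad', fun hfeas => ?_⟩
  set safe : Set Ω := {ω | H (t + 1) ω *ᵥ x (t + 1) ω ≤ h (t + 1) ω}
  have hcompl : P.real safeᶜ ≤ δ := by
    refine ENNReal.toReal_le_of_le_ofReal hδ.le ((measure_mono_ae ?_).trans hbad)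
    filter_upwards [hfeas] with ω hω hviol
    exact ⟨hω, hviol⟩
  have hunion : 1 ≤ P.real safe + P.real safeᶜ := by
    rw [← probReal_univ (μ := P), ← Set.union_compl_self safe]
    exact measureReal_union_le _ _
  linarith
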